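/- Let $\mathcal X,\mathcal Y$ be finite alphabets; logarithms are to base $2$ and $[t]^+=\max(0,t)$. For a distribution $P_{XY}$ on $\mathcal X\times\mathcal Y$, let $(X_i,Y_i)$ be i.i.d. with law $P_{XY}$. A code of blocklength $n$ is a pair $\psi:\mathcal X^n\to\mathcal M$, $\varphi:\mathcal M\times\mathcal Y^n\to\mathcal X^n$ with $\mathcal M$ finite, and $P_e(\psi,\varphi)=\Pr\big(\varphi(\psi(X^n),Y^n)\neq X^n\big)$. The reliability function is $$\theta(R,P_{XY})=\lim_{\epsilon\downarrow0}\ \liminf_{n\to\infty}\ -\frac1n\log\Big[\min_{(\psi,\varphi):\ \frac1n\log|\mathcal M|\le R+\epsilon}P_e(\psi,\varphi)\Big]\in[0,\infty].$$ The characteristic graph $G_X$ of $P_{XY}$ has vertex set $\mathcal X$, with $x\ne x'$ adjacent iff $P_{XY}(x,y)P_{XY}(x',y)>0$ for some $y$. Its chromatic number is $\gamma(G_X)$. $G_X^n$ is the $n$-fold strong product: distinct vectors in $\mathcal X^n$ are adjacent iff in each coordinate they are equal or adjacent in $G_X$. For a graph $G$ on $\mathcal X$ and a distribution $Q$ on $\mathcal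 X$, let $\kappa(G,Q)=\max_V H(V|Q)$, where $V$ ranges over the stochastic matrices with $QV=Q$ and $V(b|a)=0$ whenever $a\neq b$ are not adjacent in $G$, and $H(V|Q)=-\sum_a Q(a)\sum_b V(b|a)\log V(b|a)$. Put $$E(R,P_{XY})=\inf\Big\{D(Q_{XY}\|P_{XY})+\big[R-H_Q(X|Y)\big]^+ :\ \min\big(\kappa(G_X,Q_X),\log\gamma(G_X)\big)\ge R\Big\},$$ the infimum being over distributions $Q_{XY}$ on $\mathcal X\times\mathcal Y$, with $\inf\emptyset=+\infty$. Theorem. Let $R>0$. (1) For every $P_{XY}$ the limit defining $\theta(R,P_{XY})$ exists and $\theta(R,P_{XY})\ge E(R,P_{XY})$. (2) The exponent $E(R,P_{XY})$ is achieved by the following semi-universal scheme, which depends on $P_{XY}$ only through its support $S=\{(x,y):P_{XY}(x,y)>0\}$. For every type $\tau$ of strings of length $n$ fix a proper coloring, with as many colors as its chromatic number $\gamma_\tau$, of the subgraph of $G_X^n$ induced by the type class $T_\tau$. Assign to all strings independent, uniformly distributed bin indices in $\{1,\dots,\lfloor 2^{nR}\rfloor\}$, known to encoder and decoder. The encoder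 sends the type $\tau$ of $\mathbf x$ (one of at most $(n+1)^{|\mathcal X|}$ indices) together with the color of $\mathbf x$ if $\gamma_\tau<2^{nR}$, and with its bin index otherwise. If $\gamma_\tau<2^{nR}$, the decoder outputs a string $\mathbf x\in T_\tau$ with the received color and $(x_i,y_i)\in S$ for all $i$, if there is one. Otherwise it outputs a string of $T_\tau$ in the received bin with least empirical conditional entropy $H(\mathbf x|\mathbf y)$, if there is one. For every possible nonempty support $S$ and every $n$ such a scheme exists; the rate $\frac1n\log|\mathcal M|$ of its message set $\mathcal M=\{1,\dots,\lfloor2^{nR}\rfloor\}\times\{1,\dots,(n+1)^{|\mathcal X|}\}$ is at most $R+\epsilon$ for all large $n$, for each $\epsilon>0$. For any choice of the colorings and of the tie-breaking (and default outputs) of the decoder, and every $P_{XY}$ with support $S$, the error probability $\bar P_e^{(n)}$ of the scheme, averaged over the random binning, satisfies $\liminf_{n\to\infty}-\frac1n\log\bar P_e^{(n)}\ge E(R,P_{XY})$. -/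

import Mathlib

open Filter Topology
open scoped ENNReal

noncomputable section

namespace SideInfo

/-! Information measures on finite alphabets; all logarithms are to base two. -/

/-- The first marginal `Q_X` of a joint distribution. -/
def margX {X Y : Type*} [Fintype Y] (Q : X × Y → ℝ) (x : X) : ℝ := ∑ y, Q (x, y)

/-- The second marginal `Q_Y` of a joint distribution. -/
def margY {X Y : Type*} [Fintype X] (Q : X × Y → ℝ) (y : Y) : ℝ := ∑ x, Q (x, y)

/-- The conditional entropy `H_Q(X|Y)` (terms with `Q (x, y) = 0` vanish). -/
def condEntropy {X Y : Type*} [Fintype X] [Fintype Y] (Q : X × Y → ℝ) : ℝ :=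
  -∑ x, ∑ y, Q (x, y) * Real.logb 2 (Q (x, y) / margY Q y)

open Classical in
/-- The relative entropy `D(Q‖P)`, equal to `⊤` unless `Q` is absolutely continuous
with respect to `P`. -/
def relEntropy {Z : Type*} [Fintype Z] (Q P : Z → ℝ) : EReal :=
  if ∀ z, P z = 0 → Q z = 0 then ((∑ z, Q z * Real.logb 2 (Q z / P z) : ℝ) : EReal) else ⊤

/-- `H(V|Q)` for a stochastic matrix `V`, where `V a b` stands for `V(b|a)`. -/
def channelEntropy {X : Type*} [Fintype X] (Q : X → ℝ) (V : X → X → ℝ) : ℝ :=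
  ∑ a, Q a * -∑ b, V a b * Real.logb 2 (V a b)

/-- The matrices over which the functional `κ(G, Q)` maximizes: stochastic matrices `V` with
`V ≪ G` (entries vanish off the diagonal and off the edges of `G`) and `Q V = Q`. -/
def admissibleChannels {X : Type*} [Fintype X] (G : SimpleGraph X) (Q : X → ℝ) :
    Set (X → X → ℝ) :=
  {V | (∀ a, V a ∈ stdSimplex ℝ X) ∧ (∀ a b, a ≠ b → ¬ G.Adj a b → V a b = 0) ∧
    ∀ b, ∑ a, Q a * V a b = Q b}

/-- `κ(G, Q)`, the maximum of `H(V|Q)` over the admissible channels. For a distribution `Q` the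
set of values is compact and nonempty (it contains the value at the identity matrix). -/
def kappa {X : Type*} [Fintype X] (G : SimpleGraph X) (Q : X → ℝ) : ℝ :=
  sSup (channelEntropy Q '' admissibleChannels G Q)

/-! Graphs. -/

/-- The chromatic number as a natural number (finite on finite vertex sets). -/
def chromNum {V : Type*} (G : SimpleGraph V) : ℕ := G.chromaticNumber.toNat

/-- The `n`-fold strong product of a graph with itself: distinct vectors are adjacent when in
each coordinate they agree or are adjacent. -/
def strongPower {V : Type*} (G : SimpleGraph V) (n : ℕ) : SimpleGraph (Fin n → V) where
  Adj u v := u ≠ v ∧ ∀ i, u i = v i ∨ G.Adj (u i) (v i)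
  symm := ⟨fun _ _ h => ⟨h.1.symm, fun i => (h.2 i).imp Eq.symm fun k => k.symm⟩⟩
  loopless := ⟨fun _ h => h.1 rfl⟩

/-- The support of a joint distribution, i.e. the positions of its nonzero entries. -/
def supp {X Y : Type*} (P : X × Y → ℝ) : Set (X × Y) := {z | 0 < P z}

/-- The characteristic graph of a source with support `S`: distinct `x`, `x'` are adjacent when
some `y` has positive probability jointly with each of them. -/
def charGraph {X Y : Type*} (S : Set (X × Y)) : SimpleGraph X where
  Adj x x' := x ≠ x' ∧ ∃ y, (x, y) ∈ S ∧ (x', y) ∈ S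
  symm := ⟨fun _ _ h => ⟨h.1.symm, h.2.imp fun _ k => ⟨k.2, k.1⟩⟩⟩
  loopless := ⟨fun _ h => h.1 rfl⟩

/-! Block codes and the reliability function. -/

open Classical in
/-- The probability that `X^n ≠ φ(ψ(X^n), Y^n)` when `(X_i, Y_i)` are i.i.d. with law `P`. -/
def errorProb {X Y M : Type*} [Fintype X] [Fintype Y] (P : X × Y → ℝ) {n : ℕ}
    (ψ : (Fin n → X) → M) (φ : M × (Fin n → Y) → (Fin n → X)) : ℝ :=
  ∑ x : Fin n → X, ∑ y : Fin n → Y, if φ (ψ x, y) ≠ x then ∏ i, P (x i, y i) else 0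

/-- `-(1/n) log₂ p`, with value `⊤` at `p = 0`. -/
def errorExponent (n : ℕ) (p : ℝ≥0∞) : EReal :=
  -ENNReal.log p / ((n * Real.log 2 : ℝ) : EReal)

/-- The least error probability of an encoder/decoder pair of blocklength `n` whose message set
has `m` elements with `(1/n) log₂ m ≤ r`. -/
def minErrorProb {X Y : Type*} [Fintype X] [Fintype Y] (P : X × Y → ℝ) (r : ℝ) (n : ℕ) : ℝ≥0∞ :=
  ⨅ (m : ℕ) (_ : 1 / (n : ℝ) * Real.logb 2 m ≤ r) (ψ : (Fin n → X) → Fin m)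
    (φ : Fin m × (Fin n → Y) → (Fin n → X)), ENNReal.ofReal (errorProb P ψ φ)

/-- `liminf_n -(1/n) log₂ (min P_e)`, the minimum being over codes of rate at most `r`. -/
def exponentAtRate {X Y : Type*} [Fintype X] [Fintype Y] (P : X × Y → ℝ) (r : ℝ) : EReal :=
  liminf (fun n : ℕ => errorExponent n (minErrorProb P r n)) atTop

/-- The reliability function `θ(R, P)`, the limit as `ε ↓ 0` of the exponent at rate `R + ε`. -/
def reliability {X Y : Type*} [Fintype X] [Fintype Y] (R : ℝ) (P : X × Y → ℝ) : EReal :=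
  limUnder (𝓝[>] (0 : ℝ)) fun ε : ℝ => exponentAtRate P (R + ε)

/-- The single-letter exponent: the infimum of `D(Q‖P) + (R - H_Q(X|Y))⁺` over the joint
distributions `Q` with `min (κ(G_X, Q_X), log₂ γ(G_X)) ≥ R` (`⊤` if there is none). -/
def singleLetterExponent {X Y : Type*} [Fintype X] [Fintype Y] (R : ℝ) (P : X × Y → ℝ) : EReal :=
  ⨅ Q ∈ {Q : X × Y → ℝ | Q ∈ stdSimplex ℝ (X × Y) ∧
      R ≤ min (kappa (charGraph (supp P)) (margX Q))
        (Real.logb 2 (chromNum (charGraph (supp P))))},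
    relEntropy Q P + ((max 0 (R - condEntropy Q) : ℝ) : EReal)

/-! The semi-universal scheme. -/

open Classical in
/-- The type of a string, recorded through its letter counts. -/
def typeOf {X : Type*} {n : ℕ} (x : Fin n → X) : X → Fin (n + 1) := fun a =>
  ⟨(Finset.univ.filter fun i => x i = a).card,
    Nat.lt_succ_of_le ((Finset.card_filter_le _ _).trans (by simp))⟩

/-- The strings of a given type. -/
def typeClass {X : Type*} {n : ℕ} (τ : X → Fin (n + 1)) : Set (Fin n → X) := {x | typeOf x = τ}

open Classical in
/-- The joint empirical distribution of two strings. -/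
def empirical {X Y : Type*} {n : ℕ} (x : Fin n → X) (y : Fin n → Y) (z : X × Y) : ℝ :=
  ((Finset.univ.filter fun i => (x i, y i) = z).card : ℝ) / n

/-- The empirical conditional entropy `H(x|y)` of two strings. -/
def empEntropy {X Y : Type*} [Fintype X] [Fintype Y] {n : ℕ}
    (x : Fin n → X) (y : Fin n → Y) : ℝ :=
  condEntropy (empirical x y)

/-- The chromatic number of the subgraph of `G_X^n` induced by a type class. -/
def classChrom {X Y : Type*} (S : Set (X × Y)) {n : ℕ} (τ : X → Fin (n + 1)) : ℕ :=
  chromNum ((strongPower (charGraph S) n).induce (typeClass τ))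

/-- The number of bins, `2^(nR)` rounded down. -/
def numBins (R : ℝ) (n : ℕ) : ℕ := ⌊(2 : ℝ) ^ ((n : ℝ) * R)⌋₊

/-- The type class is coloured (and not binned) when its chromatic number is below `2^(nR)`. -/
def IsColored {X Y : Type*} (S : Set (X × Y)) (R : ℝ) {n : ℕ} (τ : X → Fin (n + 1)) : Prop :=
  (classChrom S τ : ℝ) < (2 : ℝ) ^ ((n : ℝ) * R)

/-- A message is a colour or bin index together with a type. -/
abbrev Message (X : Type*) (R : ℝ) (n : ℕ) : Type _ := Fin (numBins R n) × (X → Fin (n + 1))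

/-- A binning of the strings, and so of each type class. -/
abbrev Binning (X : Type*) (R : ℝ) (n : ℕ) : Type _ := (Fin n → X) → Fin (numBins R n)

/-- An instance of the scheme at blocklength `n`. It depends on the source only through the
support `S`. The decoder is told the binning `b`. For coloured type classes it looks for a
string of the given type and colour that is compatible with `y`; for binned ones it picks a
string of least empirical conditional entropy in the bin. Ties, and the output when there is no
candidate, are arbitrary. -/
structure Scheme {X Y : Type*} [Fintype X] [Fintype Y] (S : Set (X × Y)) (R : ℝ) (n : ℕ) where
  /-- the colour of a string within its type class -/
  color : (Fin n → X) → ℕ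
  color_lt : ∀ x, color x < classChrom S (typeOf x)
  color_proper : ∀ x x', typeOf x = typeOf x' → (strongPower (charGraph S) n).Adj x x' →
    color x ≠ color x'
  /-- the decoder, given the binning -/
  decode : Binning X R n → Message X R n × (Fin n → Y) → (Fin n → X)
  decode_colored : ∀ b u τ y, IsColored S R τ →
    (∃ x ∈ typeClass τ, color x = u.val ∧ ∀ i, (x i, y i) ∈ S) →
    decode b ((u, τ), y) ∈ typeClass τ ∧ color (decode b ((u, τ), y)) = u.val ∧
      ∀ i, (decode b ((u, τ), y) i, y i) ∈ S
  decode_binned : ∀ b u τ y, ¬ IsColored S R τ →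
    (∃ x ∈ typeClass τ, b x = u) →
    decode b ((u, τ), y) ∈ typeClass τ ∧ b (decode b ((u, τ), y)) = u ∧
      ∀ x ∈ typeClass τ, b x = u → empEntropy (decode b ((u, τ), y)) y ≤ empEntropy x y

open Classical in
/-- The encoder sends the type, and the colour or the bin of the string. -/
def Scheme.encode {X Y : Type*} [Fintype X] [Fintype Y] {S : Set (X × Y)} {R : ℝ} {n : ℕ}
    (c : Scheme S R n) (b : Binning X R n) (x : Fin n → X) : Message X R n :=
  (if h : IsColored S R (typeOf x) then
      ⟨c.color x, (c.color_lt x).trans_le (Nat.le_floor (le_of_lt h))⟩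
    else b x, typeOf x)

open Classical in
/-- The error probability of the scheme under a uniformly random binning, i.e. one in which the
strings receive independent uniform bin indices. -/
def Scheme.errorProb {X Y : Type*} [Fintype X] [Fintype Y] {S : Set (X × Y)} {R : ℝ} {n : ℕ}
    (c : Scheme S R n) (P : X × Y → ℝ) : ℝ :=
  (∑ b : Binning X R n, SideInfo.errorProb P (c.encode b) (c.decode b)) /
    Fintype.card (Binning X R n)

end SideInfo

end

/-! Strings in a coloured type class are never decoded wrongly. Two strings of one type that are
both compatible with `y` are equal or adjacent in the strong power, so a proper coloring separates
them. Errors come only from types with `γ_τ ≥ 2^(nR)`.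

For such a type the chromatic number is bounded in two ways. Coloring coordinatewise gives `γ_τ ≤
γ(G)^n`, hence `R ≤ log γ(G)`. Greedy coloring bounds `γ_τ` by the largest closed neighborhood. If
`x'` is in the closed neighborhood of `x` within its type class, their joint type has equal
marginals and lives on the diagonal and the edges of `G`, so its conditional law is an admissible
channel and `H(x'|x) ≤ κ`. Counting strings of small conditional entropy gives `γ_τ ≤ poly(n)
2^(nκ)`, hence `R ≤ κ + O(log n / n)` (`classChrom_le`, `le_of_not_isColored`).

For a pair of joint type `Q`, a union bound over the competitors in the bin shows that minimum
entropy decoding fails with probability at most `poly(n) 2^(-n[R - H_Q(X|Y)]⁺)`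
(`Scheme.failProb_le`), while the pairs of joint type `Q` have total probability at most
`2^(-nD(Q‖P))`. There are polynomially many joint types, so the exponent is at least the least
objective over types with `R ≤ κ + o(1)`.

The `o(1)` is removed by compactness: for `a` below the single-letter exponent, the distributions
with objective at most `a` that satisfy `R ≤ log γ(G)` have `κ` bounded away from `R`
(`exists_kappa_le_sub`). Finally some binning is no worse than the average, and monotonicity in the
rate gives the limit defining `θ`. -/

namespace SideInfo

/-! ### Method of types -/

section Types

variable {X Y : Type*} {n : ℕ}

open Classical in
/-- A product along a string is determined by the letter frequencies. -/
theorem prod_eq_two_rpow {Z : Type*} [Fintype Z] (z : Fin n → Z) (f : Z → ℝ)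
    (hf : ∀ i, 0 < f (z i)) :
    ∏ i, f (z i) = (2 : ℝ) ^ ((n : ℝ) *
      ∑ w, ((Finset.univ.filter fun i => z i = w).card : ℝ) / n * Real.logb 2 (f w)) := by
  have h1 : ∏ i, f (z i) = (2 : ℝ) ^ (∑ i, Real.logb 2 (f (z i))) := by
    rw [Real.rpow_sum_of_pos two_pos]
    exact Finset.prod_congr rfl fun i _ =>
      (Real.rpow_logb two_pos (by norm_num) (hf i)).symm
  rw [h1]
  congr 1
  rcases Nat.eq_zero_or_pos n with rfl | hn
  · simp
  rw [Finset.mul_sum, ← Finset.sum_fiberwise Finset.univ z]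
  refine Finset.sum_congr rfl fun w _ => ?_
  rw [Finset.sum_congr rfl (g := fun _ => Real.logb 2 (f w))
    (fun i hi => by rw [(Finset.mem_filter.1 hi).2])]
  rw [Finset.sum_const, nsmul_eq_mul]
  field_simp

theorem sum_prod_eq_prod_sum {A : Type*} [Fintype A] (f : Fin n → A → ℝ) :
    ∑ x : Fin n → A, ∏ i, f i (x i) = ∏ i, ∑ a, f i a := by
  classical
  rw [Finset.prod_univ_sum, Fintype.piFinset_univ]

theorem empirical_nonneg (x : Fin n → X) (y : Fin n → Y) (z : X × Y) : 0 ≤ empirical x y z := by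
  unfold empirical; positivity

theorem empirical_pos (hn : 0 < n) (x : Fin n → X) (y : Fin n → Y) (i : Fin n) :
    0 < empirical x y (x i, y i) := by
  classical
  unfold empirical
  have : 0 < (Finset.univ.filter fun j => (x j, y j) = (x i, y i)).card :=
    Finset.card_pos.2 ⟨i, by simp⟩
  have hn' : (0 : ℝ) < n := by exact_mod_cast hn
  exact div_pos (by exact_mod_cast this) hn'

theorem exists_of_empirical_ne_zero {x : Fin n → X} {y : Fin n → Y} {z : X × Y}
    (h : empirical x y z ≠ 0) : ∃ i, (x i, y i) = z := by
  classical
  by_contra! hc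
  apply h
  unfold empirical
  rw [Finset.filter_false_of_mem (fun i _ => hc i)]
  simp

theorem margX_empirical [Fintype Y] (x : Fin n → X) (y : Fin n → Y) (a : X) :
    margX (empirical x y) a = ((typeOf x a : ℕ) : ℝ) / n := by
  classical
  have h : ((typeOf x a : ℕ) : ℝ) = ((Finset.univ.filter fun i => x i = a).card : ℝ) := by
    simp [typeOf]
  rw [h]
  unfold margX empirical
  rw [← Finset.sum_div]
  congr 1
  norm_cast
  rw [Finset.card_eq_sum_card_fiberwise (f := y) (t := Finset.univ) (by simp)]
  refine Finset.sum_congr rfl fun b _ => ?_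
  rw [Finset.filter_filter]
  congr 1
  ext i
  simp

theorem margY_empirical [Fintype X] (x : Fin n → X) (y : Fin n → Y) (b : Y) :
    margY (empirical x y) b = ((typeOf y b : ℕ) : ℝ) / n := by
  classical
  rw [← margX_empirical y x]
  unfold margY margX empirical
  refine Finset.sum_congr rfl fun a _ => ?_
  congr 3
  ext i
  simp [and_comm]

variable [Fintype X] [Fintype Y]

theorem empirical_mem_stdSimplex (hn : 0 < n) (x : Fin n → X) (y : Fin n → Y) :
    empirical x y ∈ stdSimplex ℝ (X × Y) := by
  classical
  refine ⟨empirical_nonneg x y, ?_⟩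
  have hn' : (n : ℝ) ≠ 0 := by exact_mod_cast hn.ne'
  unfold empirical
  rw [← Finset.sum_div, div_eq_one_iff_eq hn']
  norm_cast
  rw [← Finset.card_eq_sum_card_fiberwise (f := fun i => (x i, y i)) (by simp)]
  simp

open Classical in
/-- The functions on `X × Y` that are possible joint types at blocklength `n`. -/
theorem exists_types_finset (X Y : Type*) [Fintype X] [Fintype Y] (n : ℕ) :
    ∃ T : Finset (X × Y → ℝ),
      T.card ≤ (n + 1) ^ (Fintype.card X * Fintype.card Y) ∧
      ∀ (x : Fin n → X) (y : Fin n → Y), empirical x y ∈ T := by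
  refine ⟨Finset.univ.image fun (c : X × Y → Fin (n + 1)) z => ((c z : ℕ) : ℝ) / n, ?_, ?_⟩
  · refine Finset.card_image_le.trans ?_
    simp
  · intro x y
    refine Finset.mem_image.2 ⟨typeOf fun i => (x i, y i), Finset.mem_univ _, ?_⟩
    ext z
    simp [empirical, typeOf]

open Classical in
/-- A conditional type class has at most `2 ^ (n H(X|Y))` elements. -/
theorem card_empirical_eq_le (hn : 0 < n) (y : Fin n → Y) (J : X × Y → ℝ) :
    ((Finset.univ.filter fun x : Fin n → X => empirical x y = J).card : ℝ) ≤
      (2 : ℝ) ^ ((n : ℝ) * condEntropy J) := by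
  rcases Finset.eq_empty_or_nonempty
    (Finset.univ.filter fun x : Fin n → X => empirical x y = J) with h0 | ⟨x₀, hx₀⟩
  · rw [h0]; simp; positivity
  have hJ0 : ∀ z, 0 ≤ J z := fun z => by
    rw [← (Finset.mem_filter.1 hx₀).2]; exact empirical_nonneg _ _ _
  have hm : ∀ i, 0 < margY J (y i) := fun i => by
    have h1 := empirical_pos hn x₀ y i
    rw [(Finset.mem_filter.1 hx₀).2] at h1
    exact h1.trans_le
      (Finset.single_le_sum (f := fun a => J (a, y i)) (fun _ _ => hJ0 _) (Finset.mem_univ _))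
  -- The conditional law of `J`, applied letter by letter along `y`, is a probability on strings
  -- `x`. It gives each string of the conditional type class the same mass `2 ^ (-n H)`, so at most
  -- `2 ^ (n H)` of them fit.
  have hsum : ∑ x : Fin n → X, ∏ i, J (x i, y i) / margY J (y i) = 1 := by
    rw [sum_prod_eq_prod_sum (fun i a => J (a, y i) / margY J (y i))]
    refine Finset.prod_eq_one fun i _ => ?_
    rw [← Finset.sum_div]
    exact div_self (hm i).ne'
  have hprod : ∀ x ∈ Finset.univ.filter fun x : Fin n → X => empirical x y = J,
      ∏ i, J (x i, y i) / margY J (y i) = (2 : ℝ) ^ (-((n : ℝ) * condEntropy J)) := by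
    intro x hx
    have hxJ := (Finset.mem_filter.1 hx).2
    have := prod_eq_two_rpow (fun i => (x i, y i)) (fun w => J w / margY J w.2) (fun i => by
      refine div_pos ?_ (hm i)
      rw [← hxJ]; exact empirical_pos hn x y i)
    rw [this]
    congr 1
    rw [condEntropy, ← Fintype.sum_prod_type']
    rw [mul_neg, neg_neg]
    congr 1
    refine Finset.sum_congr rfl fun w _ => ?_
    congr 1
    rw [← hxJ]
    unfold empirical
    congr!
  have hle : ∑ x ∈ Finset.univ.filter fun x : Fin n → X => empirical x y = J,
      ∏ i, J (x i, y i) / margY J (y i) ≤ 1 := by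
    rw [← hsum]
    refine Finset.sum_le_sum_of_subset_of_nonneg (Finset.filter_subset _ _) fun x _ _ => ?_
    exact Finset.prod_nonneg fun i _ => div_nonneg (hJ0 _) (hm i).le
  rw [Finset.sum_congr rfl hprod, Finset.sum_const, nsmul_eq_mul, Real.rpow_neg two_pos.le,
    ← div_eq_mul_inv, div_le_one (by positivity)] at hle
  exact hle

open Classical in
/-- The number of strings whose empirical conditional entropy is at most `h`. -/
theorem card_empEntropy_le (hn : 0 < n) (y : Fin n → Y) (h : ℝ) :
    ((Finset.univ.filter fun x : Fin n → X => empEntropy x y ≤ h).card : ℝ) ≤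
      ((n : ℝ) + 1) ^ (Fintype.card X * Fintype.card Y) * (2 : ℝ) ^ ((n : ℝ) * h) := by
  obtain ⟨T, hT, hmem⟩ := exists_types_finset X Y n
  have hT' : (T.card : ℝ) ≤ ((n : ℝ) + 1) ^ (Fintype.card X * Fintype.card Y) := by
    exact_mod_cast hT
  rw [Finset.card_eq_sum_card_fiberwise (f := fun x => empirical x y) (t := T)
    (fun x _ => hmem x y)]
  push_cast
  calc _ ≤ ∑ J ∈ T, (2 : ℝ) ^ ((n : ℝ) * h) := by
        refine Finset.sum_le_sum fun J _ => ?_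
        rcases Finset.eq_empty_or_nonempty (Finset.filter (fun x => empirical x y = J)
          (Finset.univ.filter fun x : Fin n → X => empEntropy x y ≤ h)) with h0 | ⟨x₀, hx₀⟩
        · rw [h0]; simp; positivity
        simp only [Finset.mem_filter, Finset.mem_univ, true_and] at hx₀
        have hJ : condEntropy J ≤ h := by rw [← hx₀.2]; exact hx₀.1
        refine le_trans ?_ ((card_empirical_eq_le hn y J).trans ?_)
        · norm_cast
          exact Finset.card_le_card (Finset.filter_subset_filter _ (Finset.filter_subset _ _))
        · exact Real.rpow_le_rpow_of_exponent_le one_le_two (by gcongr)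
    _ ≤ _ := by
        rw [Finset.sum_const, nsmul_eq_mul]
        gcongr

/-- The sum `∑ z, Q z log (Q z / P z)`, which is `D(Q‖P)` when `Q ≪ P`. -/
noncomputable def realRelEntropy {Z : Type*} [Fintype Z] (Q P : Z → ℝ) : ℝ :=
  ∑ z, Q z * Real.logb 2 (Q z / P z)

/-- The probability of a pair of strings, compared with its probability under its own type. -/
theorem prod_eq_prod_empirical_mul (hn : 0 < n) (P : X × Y → ℝ) (x : Fin n → X) (y : Fin n → Y)
    (hP : ∀ i, 0 < P (x i, y i)) :
    ∏ i, P (x i, y i) = (∏ i, empirical x y (x i, y i)) *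
      (2 : ℝ) ^ (-((n : ℝ) * realRelEntropy (empirical x y) P)) := by
  classical
  have h := prod_eq_two_rpow (fun i => (x i, y i)) (fun w => P w / empirical x y w)
    (fun i => div_pos (hP i) (empirical_pos hn x y i))
  have h2 : (2 : ℝ) ^ (-((n : ℝ) * realRelEntropy (empirical x y) P)) =
      ∏ i, P (x i, y i) / empirical x y (x i, y i) := by
    rw [h, realRelEntropy, ← mul_neg, ← Finset.sum_neg_distrib]
    congr 2
    refine Finset.sum_congr rfl fun w _ => ?_
    rw [← inv_div, Real.logb_inv, mul_neg, neg_neg]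
    congr 1
    unfold empirical
    congr!
  rw [h2, ← Finset.prod_mul_distrib]
  refine Finset.prod_congr rfl fun i _ => ?_
  rw [mul_div_cancel₀ _ (empirical_pos hn x y i).ne']

/-- Each summand is one of the terms obtained by letting every possible joint type `J` act as an
i.i.d. law, and each such law has total mass one. The sum is thus at most the number of types. -/
theorem sum_prod_empirical_le (hn : 0 < n) :
    ∑ x : Fin n → X, ∑ y : Fin n → Y, ∏ i, empirical x y (x i, y i) ≤
      ((n : ℝ) + 1) ^ (Fintype.card X * Fintype.card Y) := by
  classical
  obtain ⟨T, hT, hmem⟩ := exists_types_finset X Y n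
  have hT' : (T.card : ℝ) ≤ ((n : ℝ) + 1) ^ (Fintype.card X * Fintype.card Y) := by
    exact_mod_cast hT
  set T' := T.filter fun J => J ∈ stdSimplex ℝ (X × Y)
  calc _ ≤ ∑ x : Fin n → X, ∑ y : Fin n → Y, ∑ J ∈ T', ∏ i, J (x i, y i) := by
        refine Finset.sum_le_sum fun x _ => Finset.sum_le_sum fun y _ => ?_
        refine Finset.single_le_sum (f := fun J : X × Y → ℝ => ∏ i, J (x i, y i))
          (fun J hJ => Finset.prod_nonneg fun i _ => (Finset.mem_filter.1 hJ).2.1 _) ?_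
        exact Finset.mem_filter.2 ⟨hmem x y, empirical_mem_stdSimplex hn x y⟩
    _ = ∑ J ∈ T', ∑ x : Fin n → X, ∑ y : Fin n → Y, ∏ i, J (x i, y i) := by
        rw [Finset.sum_congr rfl fun x _ => Finset.sum_comm]
        exact Finset.sum_comm
    _ ≤ ∑ J ∈ T', 1 := by
        refine Finset.sum_le_sum fun J hJ => ?_
        rw [Finset.sum_congr rfl fun x _ => sum_prod_eq_prod_sum (fun i b => J (x i, b)),
          sum_prod_eq_prod_sum (fun _ a => ∑ b, J (a, b)),
          Finset.prod_eq_one fun i _ => ?_]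
        rw [← Fintype.sum_prod_type']
        exact (Finset.mem_filter.1 hJ).2.2
    _ ≤ _ := by
        rw [Finset.sum_const, nsmul_eq_mul, mul_one]
        refine le_trans ?_ hT'
        exact_mod_cast Finset.card_le_card (Finset.filter_subset _ _)

end Types

/-! ### Colorings -/

section Coloring

open Classical in
/-- Greedy coloring: a finite graph whose closed neighborhoods have at most `d` elements is
`d`-colorable. -/
theorem colorable_of_card_closedNbhd_le {V : Type*} [Fintype V] (G : SimpleGraph V) (d : ℕ)
    (h : ∀ v, (Finset.univ.filter fun w => w = v ∨ G.Adj v w).card ≤ d) : G.Colorable d := by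
  -- A vertex belongs to its closed neighborhood but is not its own neighbor, so one of the `d`
  -- colors stays free.
  have h' : ∀ v, (Finset.univ.filter fun w => G.Adj v w).card < d := fun v =>
    (Finset.card_lt_card (Finset.ssubset_iff_subset_ne.2
      ⟨Finset.monotone_filter_right _ fun w _ hw => Or.inr hw, fun e => by
        have hv : v ∈ Finset.univ.filter fun w => w = v ∨ G.Adj v w := by simp
        rw [← e] at hv
        simp at hv⟩)).trans_le (h v)
  have key : ∀ s : Finset V, ∃ c : V → ℕ, (∀ v ∈ s, c v < d) ∧
      ∀ v ∈ s, ∀ w ∈ s, G.Adj v w → c v ≠ c w := by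
    intro s
    induction s using Finset.induction_on with
    | empty => exact ⟨fun _ => 0, by simp, by simp⟩
    | insert a s ha ih =>
      obtain ⟨c, hc, hp⟩ := ih
      obtain ⟨k, hk, hk'⟩ := Finset.exists_mem_notMem_of_card_lt_card
        (s := (Finset.univ.filter fun w => G.Adj a w).image c) (t := Finset.range d)
        (Finset.card_image_le.trans_lt (by simpa using h' a))
      have hne : ∀ v ∈ s, v ≠ a := fun v hv e => ha (e ▸ hv)
      have hk2 : ∀ v, G.Adj a v → c v ≠ k := fun v hv e =>
        hk' (Finset.mem_image.2 ⟨v, by simpa using hv, e⟩)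
      refine ⟨Function.update c a k, ?_, ?_⟩
      · intro v hv
        rcases Finset.mem_insert.1 hv with rfl | hv
        · simpa using hk
        · rw [Function.update_of_ne (hne v hv)]; exact hc v hv
      · intro v hv w hw hvw
        rcases Finset.mem_insert.1 hv with hva | hvs <;>
          rcases Finset.mem_insert.1 hw with hwa | hws
        · exact absurd (hva.trans hwa.symm) hvw.ne
        · rw [hva, Function.update_self, Function.update_of_ne (hne w hws)]
          exact (hk2 w (hva ▸ hvw)).symm
        · rw [hwa, Function.update_self, Function.update_of_ne (hne v hvs)]
          exact hk2 v (hwa ▸ hvw.symm)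
        · rw [Function.update_of_ne (hne w hws), Function.update_of_ne (hne v hvs)]
          exact hp v hvs w hws hvw
  obtain ⟨c, hc, hp⟩ := key Finset.univ
  exact ⟨SimpleGraph.Coloring.mk (fun v => (⟨c v, hc v (Finset.mem_univ v)⟩ : Fin d))
    fun {v w} hvw e => hp v (Finset.mem_univ v) w (Finset.mem_univ w) hvw (congrArg Fin.val e)⟩

theorem colorable_chromNum {V : Type*} [Finite V] (G : SimpleGraph V) :
    G.Colorable (chromNum G) :=
  SimpleGraph.colorable_chromaticNumber_of_fintype G

theorem chromNum_le {V : Type*} {G : SimpleGraph V} {d : ℕ} (h : G.Colorable d) :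
    chromNum G ≤ d :=
  ENat.toNat_le_of_le_natCast h.chromaticNumber_le

/-- Adjacent vectors differ in some coordinate, and there their letters are adjacent in `G`.
Coloring every coordinate separately is therefore proper. -/
theorem strongPower_colorable {V : Type*} [Finite V] (G : SimpleGraph V) (n : ℕ) :
    (strongPower G n).Colorable (chromNum G ^ n) := by
  classical
  obtain ⟨C⟩ := colorable_chromNum G
  have h : (strongPower G n).Coloring (Fin n → Fin (chromNum G)) :=
    SimpleGraph.Coloring.mk (fun x i => C (x i)) (by
      intro u v huv e
      obtain ⟨i, hi⟩ := Function.ne_iff.1 huv.1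
      exact C.valid ((huv.2 i).resolve_left hi) (congrFun e i))
  have := h.colorable
  simpa using this

theorem classChrom_le_pow {X Y : Type*} [Finite X] (S : Set (X × Y)) {n : ℕ}
    (τ : X → Fin (n + 1)) : classChrom S τ ≤ chromNum (charGraph S) ^ n :=
  chromNum_le ((strongPower_colorable (charGraph S) n).of_hom (SimpleGraph.Embedding.induce _).toHom)

end Coloring

/-! ### The functional `κ` -/

section Kappa

variable {X : Type*} [Fintype X]

theorem channelEntropy_eq (Q : X → ℝ) (V : X → X → ℝ) :
    channelEntropy Q V = ∑ a, Q a * ∑ b, Real.negMulLog (V a b) / Real.log 2 := by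
  unfold channelEntropy
  refine Finset.sum_congr rfl fun a _ => ?_
  rw [← Finset.sum_neg_distrib]
  congr 1
  refine Finset.sum_congr rfl fun b _ => ?_
  rw [Real.negMulLog, Real.logb]
  ring

theorem continuous_channelEntropy :
    Continuous fun q : (X → ℝ) × (X → X → ℝ) => channelEntropy q.1 q.2 := by
  simp_rw [channelEntropy_eq]
  refine continuous_finsetSum _ fun a _ => ?_
  refine Continuous.mul (by fun_prop) (continuous_finsetSum _ fun b _ => ?_)
  refine Continuous.div_const (Real.continuous_negMulLog.comp ?_) _
  fun_prop

theorem isCompact_stochastic : IsCompact {V : X → X → ℝ | ∀ a, V a ∈ stdSimplex ℝ X} := by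
  have := isCompact_univ_pi (fun _ : X => isCompact_stdSimplex (𝕜 := ℝ) X)
  simpa [Set.pi] using this

theorem bddAbove_channelEntropy (G : SimpleGraph X) (Q : X → ℝ) :
    BddAbove (channelEntropy Q '' admissibleChannels G Q) := by
  refine BddAbove.mono (Set.image_mono fun V hV => hV.1)
    (isCompact_stochastic.bddAbove_image (f := channelEntropy Q) ?_)
  exact (continuous_channelEntropy.comp (Continuous.prodMk_right Q)).continuousOn

theorem channelEntropy_le_kappa {G : SimpleGraph X} {Q : X → ℝ} {V : X → X → ℝ}
    (hV : V ∈ admissibleChannels G Q) : channelEntropy Q V ≤ kappa G Q :=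
  le_csSup (bddAbove_channelEntropy G Q) ⟨V, hV, rfl⟩

open Classical in
theorem one_mem_admissibleChannels (G : SimpleGraph X) (Q : X → ℝ) :
    (fun a b => if a = b then 1 else 0) ∈ admissibleChannels G Q := by
  refine ⟨fun a => ⟨fun b => by positivity, by simp⟩, fun a b h _ => by simp [h], fun b => by simp⟩

theorem kappa_le {G : SimpleGraph X} {Q : X → ℝ} {r : ℝ}
    (h : ∀ V ∈ admissibleChannels G Q, channelEntropy Q V ≤ r) : kappa G Q ≤ r := by
  classical
  refine csSup_le ⟨_, _, one_mem_admissibleChannels G Q, rfl⟩ ?_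
  rintro _ ⟨V, hV, rfl⟩
  exact h V hV

/-- A joint distribution on `X × X` with equal marginals, supported on the diagonal and the edges
of `G`, has conditional entropy at most `κ`. -/
theorem condEntropy_le_kappa (G : SimpleGraph X) (J : X × X → ℝ) (hJ : ∀ z, 0 ≤ J z)
    (hm : margX J = margY J) (hG : ∀ a b, a ≠ b → ¬ G.Adj a b → J (b, a) = 0) :
    condEntropy J ≤ kappa G (margY J) := by
  classical
  have h0 : ∀ a, margY J a = 0 → ∀ b, J (b, a) = 0 := fun a ha b =>
    (Finset.sum_eq_zero_iff_of_nonneg fun b _ => hJ (b, a)).1 ha b (Finset.mem_univ b)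
  -- The conditional law of the first coordinate given the second. Rows of zero mass are filled with
  -- the identity, so that they are stochastic and respect the graph; they do not contribute to the
  -- entropy.
  set V : X → X → ℝ := fun a b =>
    if margY J a = 0 then (if a = b then 1 else 0) else J (b, a) / margY J a with hVdef
  have hmn : ∀ a, 0 ≤ margY J a := fun a => Finset.sum_nonneg fun b _ => hJ _
  have hmul : ∀ a b, margY J a * V a b = J (b, a) := by
    intro a b
    by_cases ha : margY J a = 0
    · rw [ha, zero_mul, h0 a ha]
    · simp only [hVdef, if_neg ha]; exact mul_div_cancel₀ _ ha
  have hV : V ∈ admissibleChannels G (margY J) := by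
    refine ⟨fun a => ⟨fun b => ?_, ?_⟩, fun a b hab hadj => ?_, fun b => ?_⟩
    · by_cases ha : margY J a = 0
      · simp only [hVdef, if_pos ha]; positivity
      · simp only [hVdef, if_neg ha]; exact div_nonneg (hJ _) (hmn a)
    · by_cases ha : margY J a = 0
      · simp [hVdef, if_pos ha]
      · simp only [hVdef, if_neg ha]
        rw [← Finset.sum_div]
        exact div_self ha
    · by_cases ha : margY J a = 0
      · simp [hVdef, if_pos ha, hab]
      · simp [hVdef, if_neg ha, hG a b hab hadj]
    · rw [Finset.sum_congr rfl fun a _ => hmul a b, ← hm]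
      rfl
  refine le_of_eq_of_le ?_ (channelEntropy_le_kappa hV)
  unfold condEntropy channelEntropy
  rw [Finset.sum_comm, ← Finset.sum_neg_distrib]
  refine Finset.sum_congr rfl fun a _ => ?_
  rw [mul_neg, Finset.mul_sum]
  congr 1
  refine Finset.sum_congr rfl fun b _ => ?_
  rw [← mul_assoc, hmul]
  by_cases ha : margY J a = 0
  · rw [h0 a ha]; simp
  · simp only [hVdef, if_neg ha]

theorem empEntropy_le_kappa (G : SimpleGraph X) {n : ℕ} (x x' : Fin n → X)
    (ht : typeOf x' = typeOf x) (hadj : ∀ i, x' i = x i ∨ G.Adj (x' i) (x i)) :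
    empEntropy x' x ≤ kappa G (fun a => ((typeOf x a : ℕ) : ℝ) / n) := by
  have h1 : margY (empirical x' x) = fun a => ((typeOf x a : ℕ) : ℝ) / n :=
    funext fun a => margY_empirical x' x a
  rw [← h1]
  refine condEntropy_le_kappa G _ (empirical_nonneg _ _) ?_ ?_
  · ext a
    rw [margX_empirical, margY_empirical, ht]
  · intro a b hab hn
    by_contra hne
    obtain ⟨i, hi⟩ := exists_of_empirical_ne_zero hne
    obtain ⟨rfl, rfl⟩ := Prod.mk.inj hi
    exact (hadj i).elim (fun e => hab e.symm) fun h => hn h.symm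

end Kappa

/-! ### Chromatic numbers of type classes. -/

section ClassChrom

variable {X Y : Type*} [Fintype X]

/-- The chromatic number of a type class is at most `2 ^ (n κ)` up to a polynomial factor. -/
theorem classChrom_le {n : ℕ} (hn : 0 < n) (S : Set (X × Y)) (τ : X → Fin (n + 1)) :
    (classChrom S τ : ℝ) ≤ ((n : ℝ) + 1) ^ (Fintype.card X * Fintype.card X) *
      (2 : ℝ) ^ ((n : ℝ) * kappa (charGraph S) (fun a => ((τ a : ℕ) : ℝ) / n)) := by
  classical
  set B := ((n : ℝ) + 1) ^ (Fintype.card X * Fintype.card X) *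
      (2 : ℝ) ^ ((n : ℝ) * kappa (charGraph S) (fun a => ((τ a : ℕ) : ℝ) / n)) with hB
  have hcol : ((strongPower (charGraph S) n).induce (typeClass τ)).Colorable ⌊B⌋₊ := by
    refine colorable_of_card_closedNbhd_le _ _ fun v => ?_
    refine Nat.le_floor (le_trans ?_ (card_empEntropy_le hn v.1
      (kappa (charGraph S) (fun a => ((τ a : ℕ) : ℝ) / n))))
    refine Nat.cast_le.2 (Finset.card_le_card_of_injOn Subtype.val (fun w hw => ?_)
      Subtype.val_injective.injOn)
    refine Finset.mem_coe.2 (Finset.mem_filter.2 ⟨Finset.mem_univ _, ?_⟩)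
    have hw' : w = v ∨ (strongPower (charGraph S) n).Adj v.1 w.1 := by
      simp only [Finset.coe_filter, Finset.mem_univ, true_and, Set.mem_ofPred_eq] at hw
      exact hw
    have hvτ : typeOf v.1 = τ := v.2
    have hwτ : typeOf w.1 = τ := w.2
    have := empEntropy_le_kappa (charGraph S) v.1 w.1 (hwτ.trans hvτ.symm) fun i => by
      rcases hw' with hwv | hadj
      · exact Or.inl (by rw [hwv])
      · exact (hadj.2 i).imp Eq.symm fun h => h.symm
    rwa [hvτ] at this
  exact (Nat.cast_le.2 (chromNum_le hcol)).trans (Nat.floor_le (by positivity))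

/-- The constraints satisfied by the types that are binned rather than colored. -/
theorem le_of_not_isColored {n : ℕ} (hn : 0 < n) {S : Set (X × Y)} {R : ℝ}
    {τ : X → Fin (n + 1)} (h : ¬ IsColored S R τ) :
    R ≤ Real.logb 2 (chromNum (charGraph S)) ∧
      R ≤ kappa (charGraph S) (fun a => ((τ a : ℕ) : ℝ) / n) +
        (Fintype.card X * Fintype.card X : ℕ) * Real.logb 2 (n + 1) / n := by
  have hn' : (0 : ℝ) < n := by exact_mod_cast hn
  have h1 : (2 : ℝ) ^ ((n : ℝ) * R) ≤ classChrom S τ := not_lt.1 h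
  constructor
  · have h2 : (2 : ℝ) ^ ((n : ℝ) * R) ≤ (chromNum (charGraph S) : ℝ) ^ n :=
      h1.trans (by exact_mod_cast classChrom_le_pow S τ)
    have h3 := Real.logb_le_logb_of_le one_lt_two (by positivity) h2
    rw [Real.logb_rpow two_pos (by norm_num), Real.logb_pow] at h3
    exact le_of_mul_le_mul_left h3 hn'
  · have h2 := Real.logb_le_logb_of_le one_lt_two (by positivity) (h1.trans (classChrom_le hn S τ))
    rw [Real.logb_rpow two_pos (by norm_num), Real.logb_mul (by positivity) (by positivity),
      Real.logb_rpow two_pos (by norm_num), Real.logb_pow] at h2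
    refine le_of_mul_le_mul_left (h2.trans_eq ?_) hn'
    field_simp
    ring

end ClassChrom

/-! ### Compactness of the optimization domain -/

section Compactness

variable {X Y : Type*} [Fintype X] [Fintype Y]

/-- Terms with `P z = 0` vanish identically, as division by zero gives zero, so continuity holds
without assuming `Q ≪ P`. -/
theorem continuous_realRelEntropy {Z : Type*} [Fintype Z] (P : Z → ℝ) :
    Continuous fun Q : Z → ℝ => realRelEntropy Q P := by
  unfold realRelEntropy
  refine continuous_finsetSum _ fun z _ => ?_
  by_cases hz : P z = 0
  · simp [hz, continuous_const]
  · have h : (fun Q : Z → ℝ => Q z * Real.logb 2 (Q z / P z)) =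
        fun Q => P z * ((Q z / P z) * Real.log (Q z / P z)) / Real.log 2 := by
      ext Q
      rw [Real.logb]
      field_simp
    rw [h]
    have hc : Continuous fun Q : Z → ℝ => (Q z / P z) * Real.log (Q z / P z) :=
      Real.continuous_mul_log.comp ((continuous_apply z).div_const _)
    exact (hc.const_mul _).div_const _

/-- The chain rule `H(X|Y) = H(X,Y) - H(Y)`, in a form free of quotients, from which continuity can
be read off. -/
theorem condEntropy_eq {Q : X × Y → ℝ} (hQ : ∀ z, 0 ≤ Q z) :
    condEntropy Q = ((∑ x, ∑ y, Real.negMulLog (Q (x, y))) -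
      ∑ y, Real.negMulLog (margY Q y)) / Real.log 2 := by
  have h : ∀ x y, Q (x, y) * Real.logb 2 (Q (x, y) / margY Q y) =
      (-Real.negMulLog (Q (x, y)) - Q (x, y) * Real.log (margY Q y)) / Real.log 2 := by
    intro x y
    by_cases h0 : Q (x, y) = 0
    · simp [h0]
    · have hm : margY Q y ≠ 0 := fun hm => h0
        ((Finset.sum_eq_zero_iff_of_nonneg fun a _ => hQ (a, y)).1 hm x (Finset.mem_univ x))
      rw [Real.logb, Real.log_div h0 hm, Real.negMulLog]
      ring
  have h2 : ∑ y, Real.negMulLog (margY Q y) = -∑ x, ∑ y, Q (x, y) * Real.log (margY Q y) := by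
    rw [Finset.sum_comm, ← Finset.sum_neg_distrib]
    refine Finset.sum_congr rfl fun y _ => ?_
    rw [← Finset.sum_mul, Real.negMulLog, neg_mul]
    rfl
  unfold condEntropy
  simp_rw [h, ← Finset.sum_div, Finset.sum_sub_distrib, Finset.sum_neg_distrib]
  rw [h2]
  ring

theorem continuousOn_condEntropy :
    ContinuousOn (fun Q : X × Y → ℝ => condEntropy Q) (stdSimplex ℝ (X × Y)) := by
  refine ContinuousOn.congr (Continuous.continuousOn ?_) fun Q hQ => condEntropy_eq hQ.1
  refine (Continuous.sub ?_ ?_).div_const _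
  · exact continuous_finsetSum _ fun x _ => continuous_finsetSum _ fun y _ =>
      Real.continuous_negMulLog.comp (continuous_apply _)
  · exact continuous_finsetSum _ fun y _ => Real.continuous_negMulLog.comp
      (continuous_finsetSum _ fun x _ => continuous_apply _)

/-- The real-valued objective `D(Q‖P) + [R - H_Q(X|Y)]⁺`, for `Q ≪ P`. -/
noncomputable def objective (R : ℝ) (P Q : X × Y → ℝ) : ℝ :=
  realRelEntropy Q P + max 0 (R - condEntropy Q)

theorem singleLetterExponent_le {R : ℝ} {P Q : X × Y → ℝ} (hQ : Q ∈ stdSimplex ℝ (X × Y))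
    (hQP : ∀ z, P z = 0 → Q z = 0) (hκ : R ≤ kappa (charGraph (supp P)) (margX Q))
    (hγ : R ≤ Real.logb 2 (chromNum (charGraph (supp P)))) :
    singleLetterExponent R P ≤ (objective R P Q : EReal) := by
  refine (iInf₂_le Q ⟨hQ, le_min hκ hγ⟩).trans_eq ?_
  rw [relEntropy, if_pos hQP, objective, EReal.coe_add]
  rfl

/-- Distributions whose objective is less than the exponent violate the constraint on `κ` by a
uniform amount. -/
theorem exists_kappa_le_sub {R : ℝ} {P : X × Y → ℝ} {a : ℝ}
    (ha : (a : EReal) < singleLetterExponent R P)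
    (hγ : R ≤ Real.logb 2 (chromNum (charGraph (supp P)))) :
    ∃ δ > 0, ∀ Q ∈ stdSimplex ℝ (X × Y), (∀ z, P z = 0 → Q z = 0) → objective R P Q ≤ a →
      kappa (charGraph (supp P)) (margX Q) ≤ R - δ := by
  set G := charGraph (supp P)
  set C : Set ((X × Y → ℝ) × (X → X → ℝ)) :=
    stdSimplex ℝ (X × Y) ×ˢ {V | ∀ a, V a ∈ stdSimplex ℝ X}
  have hC : IsCompact C := (isCompact_stdSimplex (𝕜 := ℝ) (X × Y)).prod isCompact_stochastic
  -- Working with pairs `(Q, V)` turns admissibility into closed conditions and makes continuity of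
  -- `κ` in `Q` unnecessary.
  set D : Set ((X × Y → ℝ) × (X → X → ℝ)) := {q | (∀ z, P z = 0 → q.1 z = 0) ∧
    (∀ a b, a ≠ b → ¬ G.Adj a b → q.2 a b = 0) ∧
    ∀ b, ∑ a, margX q.1 a * q.2 a b = margX q.1 b}
  have hmc : ∀ b, Continuous fun q : (X × Y → ℝ) × (X → X → ℝ) => margX q.1 b := fun b => by
    unfold margX; fun_prop
  have hD : IsClosed D := by
    have h1 : IsClosed {q : (X × Y → ℝ) × (X → X → ℝ) | ∀ z, P z = 0 → q.1 z = 0} := by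
      simp only [Set.ofPred_forall]
      exact isClosed_iInter fun z => isClosed_iInter fun _ =>
        isClosed_eq (by fun_prop) continuous_const
    have h2 : IsClosed {q : (X × Y → ℝ) × (X → X → ℝ) |
        ∀ a b, a ≠ b → ¬ G.Adj a b → q.2 a b = 0} := by
      simp only [Set.ofPred_forall]
      exact isClosed_iInter fun a => isClosed_iInter fun b => isClosed_iInter fun _ =>
        isClosed_iInter fun _ => isClosed_eq (by fun_prop) continuous_const
    have h3 : IsClosed {q : (X × Y → ℝ) × (X → X → ℝ) |
        ∀ b, ∑ a, margX q.1 a * q.2 a b = margX q.1 b} := by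
      simp only [Set.ofPred_forall]
      refine isClosed_iInter fun b => isClosed_eq ?_ (hmc b)
      exact continuous_finsetSum _ fun a _ => (hmc a).mul (by fun_prop)
    exact h1.inter (h2.inter h3)
  have hCD : IsCompact (C ∩ D) := hC.inter_right hD
  have hobj : ContinuousOn (fun q : (X × Y → ℝ) × (X → X → ℝ) => objective R P q.1) (C ∩ D) := by
    unfold objective
    refine ContinuousOn.add ((continuous_realRelEntropy P).comp continuous_fst).continuousOn ?_
    refine continuousOn_const.sup (continuousOn_const.sub ?_)
    exact continuousOn_condEntropy.comp continuousOn_fst fun q hq => hq.1.1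
  have hK : IsCompact ((C ∩ D) ∩ (fun q => objective R P q.1) ⁻¹' Set.Iic a) :=
    hCD.of_isClosed_subset (hobj.preimage_isClosed_of_isClosed hCD.isClosed isClosed_Iic)
      Set.inter_subset_left
  have hent : Continuous fun q : (X × Y → ℝ) × (X → X → ℝ) =>
      channelEntropy (margX q.1) q.2 := by
    have : Continuous fun q : (X × Y → ℝ) × (X → X → ℝ) => (margX q.1, q.2) :=
      (continuous_pi hmc).prodMk continuous_snd
    exact continuous_channelEntropy.comp this
  rcases Set.eq_empty_or_nonempty ((C ∩ D) ∩ (fun q => objective R P q.1) ⁻¹' Set.Iic a)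
    with h0 | hne
  -- No pair satisfies the constraints, so the bound holds vacuously and any positive `δ` would do.
  · refine ⟨1, one_pos, fun Q hQ hQP hQa => kappa_le fun V hV => ?_⟩
    have hmem : (Q, V) ∈ (C ∩ D) ∩ (fun q => objective R P q.1) ⁻¹' Set.Iic a :=
      ⟨⟨⟨hQ, hV.1⟩, hQP, hV.2.1, hV.2.2⟩, hQa⟩
    rw [h0] at hmem
    exact hmem.elim
  · obtain ⟨q, hq, hmax⟩ := hK.exists_isMaxOn hne hent.continuousOn
    -- Otherwise the maximizing `Q` would be feasible with objective at most `a`, contradicting the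
    -- choice of `a`.
    have hlt : channelEntropy (margX q.1) q.2 < R := by
      by_contra! hge
      have hκ : R ≤ kappa G (margX q.1) :=
        hge.trans (channelEntropy_le_kappa ⟨hq.1.1.2, hq.1.2.2.1, hq.1.2.2.2⟩)
      have h1 := singleLetterExponent_le hq.1.1.1 hq.1.2.1 hκ hγ
      have h2 : objective R P q.1 ≤ a := hq.2
      exact absurd (ha.trans_le h1) (not_lt.2 (EReal.coe_le_coe_iff.2 h2))
    refine ⟨R - channelEntropy (margX q.1) q.2, sub_pos.2 hlt,
      fun Q hQ hQP hQa => kappa_le fun V hV => ?_⟩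
    have hmem : (Q, V) ∈ (C ∩ D) ∩ (fun q => objective R P q.1) ⁻¹' Set.Iic a :=
      ⟨⟨⟨hQ, hV.1⟩, hQP, hV.2.1, hV.2.2⟩, hQa⟩
    have := hmax hmem
    simpa using this

theorem tendsto_mul_logb_succ_div (k : ℕ) :
    Tendsto (fun n : ℕ => (k : ℝ) * Real.logb 2 ((n : ℝ) + 1) / n) atTop (𝓝 0) := by
  have h1 : Tendsto (fun n : ℕ => Real.log ((n : ℝ) + 1) / ((n : ℝ) + 1)) atTop (𝓝 0) := by
    have h := (Real.isLittleO_log_id_atTop.tendsto_div_nhds_zero).comp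
      (tendsto_atTop_add_const_right atTop (1 : ℝ) tendsto_natCast_atTop_atTop)
    simpa [Function.comp_def] using h
  have h2 : Tendsto (fun n : ℕ => 1 + 1 / (n : ℝ)) atTop (𝓝 (1 + 0)) :=
    tendsto_const_nhds.add tendsto_one_div_atTop_nhds_zero_nat
  have h3 := (h1.mul h2).const_mul ((k : ℝ) / Real.log 2)
  simp only [zero_mul, mul_zero] at h3
  refine h3.congr' ?_
  filter_upwards [eventually_gt_atTop 0] with n hn
  have hn' : (n : ℝ) ≠ 0 := by exact_mod_cast hn.ne'
  rw [Real.logb]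
  field_simp

/-- Eventually, binned strings have joint types whose objective is at least `a`. -/
theorem eventually_le_objective {R : ℝ} {P : X × Y → ℝ} {a : ℝ}
    (ha : (a : EReal) < singleLetterExponent R P) :
    ∀ᶠ n : ℕ in atTop, ∀ (x : Fin n → X) (y : Fin n → Y), (∀ i, P (x i, y i) ≠ 0) →
      ¬ IsColored (supp P) R (typeOf x) → a ≤ objective R P (empirical x y) := by
  by_cases hγ : R ≤ Real.logb 2 (chromNum (charGraph (supp P)))
  · obtain ⟨δ, hδ, hκ⟩ := exists_kappa_le_sub ha hγ
    filter_upwards [eventually_gt_atTop 0,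
      (tendsto_mul_logb_succ_div (Fintype.card X * Fintype.card X)).eventually_lt_const hδ]
      with n hn hlt x y hP hcol
    by_contra! hobj
    have h1 := hκ (empirical x y) (empirical_mem_stdSimplex hn x y) (fun z hz => by
      by_contra hne
      obtain ⟨i, rfl⟩ := exists_of_empirical_ne_zero hne
      exact hP i hz) hobj.le
    have h2 := (le_of_not_isColored hn hcol).2
    rw [funext (margX_empirical x y)] at h1
    linarith
  -- When `log γ(G) < R`, every type is coloured.
  · filter_upwards [eventually_gt_atTop 0] with n hn x y _ hcol
    exact absurd (le_of_not_isColored hn hcol).1 hγ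

end Compactness

/-! ### The scheme -/

theorem numBins_pos {R : ℝ} (hR : 0 ≤ R) (n : ℕ) : 0 < numBins R n :=
  Nat.floor_pos.2 (Real.one_le_rpow one_le_two (by positivity))

theorem two_rpow_le_two_mul_numBins {R : ℝ} (hR : 0 ≤ R) (n : ℕ) :
    (2 : ℝ) ^ ((n : ℝ) * R) ≤ 2 * numBins R n := by
  have h1 : (1 : ℝ) ≤ numBins R n := by exact_mod_cast numBins_pos hR n
  have h2 := Nat.lt_floor_add_one ((2 : ℝ) ^ ((n : ℝ) * R))
  change _ < (numBins R n : ℝ) + 1 at h2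
  linarith

/-! ### Existence and rate of the scheme. -/

section Existence

variable {X Y : Type*} [Fintype X] [Fintype Y]

theorem nonempty_scheme {S : Set (X × Y)} (hS : S.Nonempty) (R : ℝ) (n : ℕ) :
    Nonempty (Scheme S R n) := by
  classical
  -- The letter `x₀` provides a default output when there is no candidate.
  obtain ⟨⟨x₀, _⟩, _⟩ := hS
  have hC : ∀ τ : X → Fin (n + 1), Nonempty
      (((strongPower (charGraph S) n).induce (typeClass τ)).Coloring (Fin (classChrom S τ))) :=
    fun τ => colorable_chromNum _
  let C := fun τ => (hC τ).some
  set color : (Fin n → X) → ℕ := fun x => C (typeOf x) ⟨x, rfl⟩ with hcolor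
  have hcol : ∀ (x : Fin n → X) τ (hx : x ∈ typeClass τ), color x = C τ ⟨x, hx⟩ := by
    rintro x _ rfl
    rfl
  have hdec : ∀ (b : Binning X R n) (q : Message X R n × (Fin n → Y)), ∃ z : Fin n → X,
      (IsColored S R q.1.2 →
        (∃ x ∈ typeClass q.1.2, color x = q.1.1.val ∧ ∀ i, (x i, q.2 i) ∈ S) →
        z ∈ typeClass q.1.2 ∧ color z = q.1.1.val ∧ ∀ i, (z i, q.2 i) ∈ S) ∧
      (¬ IsColored S R q.1.2 → (∃ x ∈ typeClass q.1.2, b x = q.1.1) →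
        z ∈ typeClass q.1.2 ∧ b z = q.1.1 ∧
          ∀ x ∈ typeClass q.1.2, b x = q.1.1 → empEntropy z q.2 ≤ empEntropy x q.2) := by
    rintro b ⟨⟨u, τ⟩, y⟩
    by_cases hc : IsColored S R τ
    · by_cases he : ∃ x ∈ typeClass τ, color x = u.val ∧ ∀ i, (x i, y i) ∈ S
      · obtain ⟨z, hz⟩ := he
        exact ⟨z, fun _ _ => hz, fun h => absurd hc h⟩
      · exact ⟨fun _ => x₀, fun _ h => absurd h he, fun h => absurd hc h⟩
    · by_cases he : ∃ x ∈ typeClass τ, b x = u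
      · obtain ⟨x, hx, hxu⟩ := he
        obtain ⟨z, hz, hmin⟩ := Finset.exists_min_image
          (Finset.univ.filter fun x => x ∈ typeClass τ ∧ b x = u) (fun x => empEntropy x y)
          ⟨x, Finset.mem_filter.2 ⟨Finset.mem_univ _, hx, hxu⟩⟩
        have hz' := (Finset.mem_filter.1 hz).2
        exact ⟨z, fun h => absurd h hc, fun _ _ => ⟨hz'.1, hz'.2, fun x hx hxu =>
          hmin x (Finset.mem_filter.2 ⟨Finset.mem_univ _, hx, hxu⟩)⟩⟩
      · exact ⟨fun _ => x₀, fun h => absurd h hc, fun _ h => absurd h he⟩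
  choose decode h1 h2 using hdec
  refine ⟨⟨color, fun x => (C (typeOf x) ⟨x, rfl⟩).isLt, fun x x' ht hadj e => ?_, decode,
    fun b u τ y => h1 b ((u, τ), y), fun b u τ y => h2 b ((u, τ), y)⟩⟩
  rw [hcol x _ rfl, hcol x' _ ht.symm] at e
  have hadj' : ((strongPower (charGraph S) n).induce (typeClass (typeOf x))).Adj
    ⟨x, rfl⟩ ⟨x', ht.symm⟩ := hadj
  exact (C (typeOf x)).valid hadj' (Fin.ext e)

theorem eventually_rate_le {R : ℝ} (hR : 0 ≤ R) {ε : ℝ} (hε : 0 < ε) :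
    ∀ᶠ n : ℕ in atTop,
      1 / (n : ℝ) * Real.logb 2 (Nat.card (Message X R n)) ≤ R + ε := by
  filter_upwards [eventually_gt_atTop 0,
    (tendsto_mul_logb_succ_div (Fintype.card X)).eventually_lt_const hε] with n hn hlt
  have hn' : (0 : ℝ) < n := by exact_mod_cast hn
  have hK : (0 : ℝ) < numBins R n := by exact_mod_cast numBins_pos hR n
  have hcard : (Nat.card (Message X R n) : ℝ) =
      numBins R n * ((n : ℝ) + 1) ^ Fintype.card X := by
    classical
    simp [Nat.card_eq_fintype_card]
  have hKle : Real.logb 2 (numBins R n) ≤ n * R := by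
    rw [Real.logb_le_iff_le_rpow one_lt_two hK]
    exact Nat.floor_le (by positivity)
  rw [hcard, Real.logb_mul hK.ne' (by positivity), Real.logb_pow, mul_add]
  refine add_le_add ?_ (le_of_eq_of_le ?_ hlt.le)
  · rw [one_div, inv_mul_le_iff₀ hn']
    exact hKle
  · field_simp

end Existence

/-! ### Error probability under random binning. -/

section Error

variable {X Y : Type*} [Fintype X] [Fintype Y] {R : ℝ} {n : ℕ}

open Classical in
/-- The probability, over the binning, that a given pair of strings is decoded wrongly. -/
noncomputable def Scheme.failProb {S : Set (X × Y)} (c : Scheme S R n) (x : Fin n → X)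
    (y : Fin n → Y) : ℝ :=
  ((Finset.univ.filter fun b : Binning X R n => c.decode b (c.encode b x, y) ≠ x).card : ℝ) /
    Fintype.card (Binning X R n)

theorem Scheme.errorProb_eq {S : Set (X × Y)} (c : Scheme S R n) (P : X × Y → ℝ) :
    c.errorProb P = ∑ x : Fin n → X, ∑ y : Fin n → Y, (∏ i, P (x i, y i)) * c.failProb x y := by
  classical
  unfold Scheme.errorProb SideInfo.errorProb
  rw [Finset.sum_comm, Finset.sum_div]
  refine Finset.sum_congr rfl fun x _ => ?_
  rw [Finset.sum_comm, Finset.sum_div]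
  refine Finset.sum_congr rfl fun y _ => ?_
  rw [← Finset.sum_filter, Finset.sum_const, nsmul_eq_mul, Scheme.failProb, mul_comm,
    mul_div_assoc]

theorem Scheme.failProb_of_isColored {S : Set (X × Y)} (c : Scheme S R n) {x : Fin n → X}
    {y : Fin n → Y} (hS : ∀ i, (x i, y i) ∈ S) (hc : IsColored S R (typeOf x)) :
    c.failProb x y = 0 := by
  classical
  unfold Scheme.failProb
  rw [Finset.filter_false_of_mem]
  · simp
  intro b _
  rw [not_not]
  have henc : c.encode b x =
      (⟨c.color x, (c.color_lt x).trans_le (Nat.le_floor (le_of_lt hc))⟩, typeOf x) := by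
    rw [Scheme.encode, dif_pos hc]
  rw [henc]
  obtain ⟨h1, h2, h3⟩ := c.decode_colored b
    ⟨c.color x, (c.color_lt x).trans_le (Nat.le_floor (le_of_lt hc))⟩ (typeOf x) y hc
    ⟨x, rfl, rfl, hS⟩
  by_contra hne
  -- The output and `x` are both compatible with `y`, so wherever they differ the letter `y i`
  -- witnesses adjacency. Sharing a color is then impossible.
  refine c.color_proper _ x h1 ⟨hne, fun i => ?_⟩ h2
  exact or_iff_not_imp_left.2 fun hi => ⟨hi, y i, h3 i, hS i⟩

/-- Two distinct points get the same uniform label with probability at most `1 / K`. -/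
theorem card_collision_mul_le {A : Type*} {K : ℕ} [Fintype (A → Fin K)] {a a' : A} (h : a' ≠ a)
    [DecidablePred fun b : A → Fin K => b a' = b a] :
    (Finset.univ.filter fun b : A → Fin K => b a' = b a).card * K ≤
      Fintype.card (A → Fin K) := by
  classical
  calc _ = ((Finset.univ.filter fun b : A → Fin K => b a' = b a) ×ˢ
        (Finset.univ : Finset (Fin K))).card := by simp
    _ ≤ _ := ?_
  -- Overwriting the label of `a'` by an arbitrary `k` loses nothing: its old value is the label of
  -- `a`, which is untouched.
  refine Finset.card_le_card_of_injOn (fun q => Function.update q.1 a' q.2)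
    (fun _ _ => Finset.mem_coe.2 (Finset.mem_univ _)) ?_
  rintro ⟨b, k⟩ hb ⟨b', k'⟩ hb' e
  have hb1 : b a' = b a := by
    simpa using (Finset.mem_product.1 (Finset.mem_coe.1 hb)).1
  have hb1' : b' a' = b' a := by
    simpa using (Finset.mem_product.1 (Finset.mem_coe.1 hb')).1
  simp only at e
  have hk : k = k' := by simpa using congrFun e a'
  have hoff : ∀ w, w ≠ a' → b w = b' w := fun w hw => by
    simpa [Function.update_of_ne hw] using congrFun e w
  refine Prod.ext (funext fun w => ?_) hk
  by_cases hw : w = a'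
  · subst hw
    exact hb1.trans ((hoff a h.symm).trans hb1'.symm)
  · exact hoff w hw

theorem Scheme.failProb_le_one {S : Set (X × Y)} (c : Scheme S R n) (x : Fin n → X)
    (y : Fin n → Y) : c.failProb x y ≤ 1 := by
  classical
  exact div_le_one_of_le₀ (by exact_mod_cast Finset.card_le_univ _) (by positivity)

open Classical in
theorem Scheme.failProb_mul_numBins_le {S : Set (X × Y)} (c : Scheme S R n) {x : Fin n → X}
    {y : Fin n → Y} (hc : ¬ IsColored S R (typeOf x)) :
    c.failProb x y * numBins R n ≤
      ((Finset.univ.filter fun x' : Fin n → X => empEntropy x' y ≤ empEntropy x y).card : ℝ) := by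
  set N := Finset.univ.filter fun x' : Fin n → X => empEntropy x' y ≤ empEntropy x y
  -- A wrong output is some `x' ≠ x` in the bin of `x` with no larger conditional entropy. It varies
  -- with the binning, so a union is taken over all such `x'`.
  have hsub : (Finset.univ.filter fun b : Binning X R n => c.decode b (c.encode b x, y) ≠ x) ⊆
      (N.erase x).biUnion fun x' => Finset.univ.filter fun b : Binning X R n => b x' = b x := by
    intro b hb
    have hne := (Finset.mem_filter.1 hb).2
    have henc : c.encode b x = (b x, typeOf x) := by rw [Scheme.encode, dif_neg hc]
    rw [henc] at hne
    obtain ⟨_, h2, h3⟩ := c.decode_binned b (b x) (typeOf x) y hc ⟨x, rfl, rfl⟩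
    exact Finset.mem_biUnion.2 ⟨_, Finset.mem_erase.2 ⟨hne, Finset.mem_filter.2
      ⟨Finset.mem_univ _, h3 x rfl rfl⟩⟩, Finset.mem_filter.2 ⟨Finset.mem_univ _, h2⟩⟩
  have hcount : (Finset.univ.filter fun b : Binning X R n =>
      c.decode b (c.encode b x, y) ≠ x).card * numBins R n ≤
      N.card * Fintype.card (Binning X R n) := by
    calc _ ≤ (∑ x' ∈ N.erase x,
          (Finset.univ.filter fun b : Binning X R n => b x' = b x).card) * numBins R n :=
        Nat.mul_le_mul_right _ ((Finset.card_le_card hsub).trans Finset.card_biUnion_le)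
      _ ≤ ∑ x' ∈ N.erase x, Fintype.card (Binning X R n) := by
        rw [Finset.sum_mul]
        exact Finset.sum_le_sum fun x' hx' => card_collision_mul_le (Finset.ne_of_mem_erase hx')
      _ ≤ _ := by
        rw [Finset.sum_const, smul_eq_mul]
        exact Nat.mul_le_mul_right _ (Finset.card_le_card (Finset.erase_subset _ _))
  unfold Scheme.failProb
  rw [div_mul_eq_mul_div]
  refine div_le_of_le_mul₀ (by positivity) (by positivity) ?_
  exact_mod_cast hcount

/-- The union bound is used when `H(x|y) ≤ R`, the trivial bound by one otherwise; this produces the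
positive part. The factor `2` pays for rounding the number of bins down. -/
theorem Scheme.failProb_le {S : Set (X × Y)} (hR : 0 ≤ R) (hn : 0 < n) (c : Scheme S R n)
    {x : Fin n → X} {y : Fin n → Y} (hc : ¬ IsColored S R (typeOf x)) :
    c.failProb x y ≤ 2 * ((n : ℝ) + 1) ^ (Fintype.card X * Fintype.card Y) *
      (2 : ℝ) ^ (-((n : ℝ) * max 0 (R - empEntropy x y))) := by
  have hpoly : (1 : ℝ) ≤ ((n : ℝ) + 1) ^ (Fintype.card X * Fintype.card Y) :=
    one_le_pow₀ (by linarith [(Nat.cast_nonneg n : (0 : ℝ) ≤ n)])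
  rcases le_total (R - empEntropy x y) 0 with h | h
  · rw [max_eq_left h, mul_zero, neg_zero, Real.rpow_zero, mul_one]
    exact (c.failProb_le_one x y).trans (by linarith)
  · rw [max_eq_right h]
    have h1 := (c.failProb_mul_numBins_le hc (y := y)).trans (card_empEntropy_le hn y _)
    have h2 := two_rpow_le_two_mul_numBins hR n
    have hf : 0 ≤ c.failProb x y := by unfold Scheme.failProb; positivity
    have h3 : (2 : ℝ) ^ (-((n : ℝ) * (R - empEntropy x y))) =
        (2 : ℝ) ^ ((n : ℝ) * empEntropy x y) / (2 : ℝ) ^ ((n : ℝ) * R) := by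
      rw [← Real.rpow_sub two_pos]
      congr 1
      ring
    rw [h3, ← mul_div_assoc, le_div_iff₀ (by positivity)]
    nlinarith [mul_le_mul_of_nonneg_left h2 hf]

/-- The error bound, given a lower bound on the objective over the joint types of binned
strings. -/
theorem Scheme.errorProb_le {S : Set (X × Y)} (hR : 0 ≤ R) (hn : 0 < n) (c : Scheme S R n)
    {P : X × Y → ℝ} (hP : ∀ z, 0 ≤ P z) (hS : supp P = S) {a : ℝ}
    (ha : ∀ (x : Fin n → X) (y : Fin n → Y), (∀ i, P (x i, y i) ≠ 0) →
      ¬ IsColored (supp P) R (typeOf x) → a ≤ objective R P (empirical x y)) :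
    c.errorProb P ≤ 2 * (((n : ℝ) + 1) ^ (Fintype.card X * Fintype.card Y)) ^ 2 *
      (2 : ℝ) ^ (-((n : ℝ) * a)) := by
  set A := ((n : ℝ) + 1) ^ (Fintype.card X * Fintype.card Y) with hA
  have key : ∀ (x : Fin n → X) (y : Fin n → Y), (∏ i, P (x i, y i)) * c.failProb x y ≤
      2 * A * (2 : ℝ) ^ (-((n : ℝ) * a)) * ∏ i, empirical x y (x i, y i) := by
    intro x y
    have hnn : 0 ≤ ∏ i, empirical x y (x i, y i) :=
      Finset.prod_nonneg fun i _ => empirical_nonneg _ _ _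
    have hrhs : 0 ≤ 2 * A * (2 : ℝ) ^ (-((n : ℝ) * a)) * ∏ i, empirical x y (x i, y i) := by
      positivity
    by_cases h0 : ∀ i, P (x i, y i) ≠ 0
    · have hpos : ∀ i, 0 < P (x i, y i) := fun i => (hP _).lt_of_ne (h0 i).symm
      by_cases hc : IsColored S R (typeOf x)
      · rw [c.failProb_of_isColored (fun i => hS ▸ hpos i) hc, mul_zero]
        exact hrhs
      · have hobj := ha x y h0 (by rwa [hS])
        have hfail := c.failProb_le hR hn hc (y := y)
        have hexp : (2 : ℝ) ^ (-((n : ℝ) * objective R P (empirical x y))) ≤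
            (2 : ℝ) ^ (-((n : ℝ) * a)) :=
          Real.rpow_le_rpow_of_exponent_le one_le_two
            (neg_le_neg (mul_le_mul_of_nonneg_left hobj (Nat.cast_nonneg n)))
        rw [prod_eq_prod_empirical_mul hn P x y hpos]
        calc _ ≤ (∏ i, empirical x y (x i, y i)) *
              (2 : ℝ) ^ (-((n : ℝ) * realRelEntropy (empirical x y) P)) *
              (2 * A * (2 : ℝ) ^ (-((n : ℝ) * max 0 (R - empEntropy x y)))) := by
              gcongr
          _ = 2 * A * (2 : ℝ) ^ (-((n : ℝ) * objective R P (empirical x y))) *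
              ∏ i, empirical x y (x i, y i) := by
              rw [objective, mul_add, neg_add, Real.rpow_add two_pos, empEntropy]
              ring
          _ ≤ _ := by gcongr
    · push Not at h0
      obtain ⟨i, hi⟩ := h0
      rw [Finset.prod_eq_zero (Finset.mem_univ i) hi, zero_mul]
      exact hrhs
  rw [c.errorProb_eq]
  calc _ ≤ ∑ x : Fin n → X, ∑ y : Fin n → Y,
        2 * A * (2 : ℝ) ^ (-((n : ℝ) * a)) * ∏ i, empirical x y (x i, y i) :=
        Finset.sum_le_sum fun x _ => Finset.sum_le_sum fun y _ => key x y
    _ = 2 * A * (2 : ℝ) ^ (-((n : ℝ) * a)) *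
        ∑ x : Fin n → X, ∑ y : Fin n → Y, ∏ i, empirical x y (x i, y i) := by
        simp_rw [Finset.mul_sum]
    _ ≤ 2 * A * (2 : ℝ) ^ (-((n : ℝ) * a)) * A := by
        gcongr
        exact sum_prod_empirical_le hn
    _ = _ := by ring

end Error

/-! ### Exponents -/

section Exponent

theorem errorExponent_anti {n : ℕ} {p q : ℝ≥0∞} (h : p ≤ q) :
    errorExponent n q ≤ errorExponent n p := by
  unfold errorExponent
  refine EReal.div_le_div_right_of_nonneg ?_ ?_
  · exact EReal.coe_nonneg.2 (by positivity)
  · exact EReal.neg_le_neg_iff.2 (ENNReal.log_monotone h)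

theorem le_errorExponent {n : ℕ} (hn : 0 < n) {p a : ℝ} (h : p ≤ (2 : ℝ) ^ (-((n : ℝ) * a))) :
    (a : EReal) ≤ errorExponent n (ENNReal.ofReal p) := by
  refine le_of_eq_of_le ?_ (errorExponent_anti (ENNReal.ofReal_le_ofReal h))
  have hn' : (n : ℝ) ≠ 0 := by exact_mod_cast hn.ne'
  have hl : Real.log 2 ≠ 0 := (Real.log_pos one_lt_two).ne'
  rw [errorExponent, ENNReal.log_ofReal_of_pos (by positivity), Real.log_rpow two_pos,
    ← EReal.coe_neg, ← EReal.coe_div]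
  congr 1
  field_simp

variable {X Y : Type*} [Fintype X] [Fintype Y] {R : ℝ}

/-- The scheme achieves the single-letter exponent. -/
theorem singleLetterExponent_le_liminf (hR : 0 ≤ R) {S : Set (X × Y)}
    (c : (n : ℕ) → Scheme S R n) {P : X × Y → ℝ} (hP : ∀ z, 0 ≤ P z) (hS : supp P = S) :
    singleLetterExponent R P ≤
      liminf (fun n : ℕ => errorExponent n (ENNReal.ofReal ((c n).errorProb P))) atTop := by
  refine le_of_forall_lt_imp_le_of_dense fun r hr => ?_
  obtain ⟨r', hrr', hr'⟩ := EReal.lt_iff_exists_real_btwn.1 hr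
  -- The gap between `r'` and `a` absorbs the polynomial factors: `1 / n` comes from the constant
  -- `2`, and `2 * k` from the count of competitors together with the count of joint types.
  obtain ⟨a, hr'a, ha⟩ := EReal.lt_iff_exists_real_btwn.1 hr'
  refine hrr'.le.trans (le_liminf_of_le (by isBoundedDefault) ?_)
  set k := Fintype.card X * Fintype.card Y
  have hlim : Tendsto (fun n : ℕ => 1 / (n : ℝ) + ((2 * k : ℕ) : ℝ) * Real.logb 2 ((n : ℝ) + 1) / n)
      atTop (𝓝 (0 + 0)) :=
    tendsto_one_div_atTop_nhds_zero_nat.add (tendsto_mul_logb_succ_div _)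
  have hpos : (0 : ℝ) + 0 < a - r' := by
    have := EReal.coe_lt_coe_iff.1 hr'a
    linarith
  filter_upwards [eventually_gt_atTop 0, eventually_le_objective ha,
    hlim.eventually_lt_const hpos] with n hn hobj hlt
  have hn' : (0 : ℝ) < n := by exact_mod_cast hn
  refine le_errorExponent hn (((c n).errorProb_le hR hn hP hS hobj).trans ?_)
  have h2 : 2 * (((n : ℝ) + 1) ^ k) ^ 2 =
      (2 : ℝ) ^ (1 + ((2 * k : ℕ) : ℝ) * Real.logb 2 ((n : ℝ) + 1)) := by
    rw [Real.rpow_add two_pos, Real.rpow_one, ← Real.logb_pow,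
      Real.rpow_logb two_pos (by norm_num) (by positivity), mul_comm 2 k,
      pow_mul ((n : ℝ) + 1) k 2]
  rw [h2, ← Real.rpow_add two_pos]
  refine Real.rpow_le_rpow_of_exponent_le one_le_two ?_
  have h3 := mul_lt_mul_of_pos_left hlt hn'
  have h4 : (n : ℝ) * (1 / (n : ℝ) + ((2 * k : ℕ) : ℝ) * Real.logb 2 ((n : ℝ) + 1) / n) =
      1 + ((2 * k : ℕ) : ℝ) * Real.logb 2 ((n : ℝ) + 1) := by
    field_simp
  rw [h4] at h3
  linarith

/-- Some binning is at least as good as the average one. -/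
theorem minErrorProb_le (hR : 0 ≤ R) {S : Set (X × Y)} {n : ℕ} (c : Scheme S R n)
    (P : X × Y → ℝ) {r : ℝ}
    (hr : 1 / (n : ℝ) * Real.logb 2 (Nat.card (Message X R n)) ≤ r) :
    minErrorProb P r n ≤ ENNReal.ofReal (c.errorProb P) := by
  classical
  have : NeZero (numBins R n) := ⟨(numBins_pos hR n).ne'⟩
  have hne : (Finset.univ : Finset (Binning X R n)).Nonempty := Finset.univ_nonempty
  obtain ⟨b, _, hb⟩ : ∃ b ∈ (Finset.univ : Finset (Binning X R n)),
      SideInfo.errorProb P (c.encode b) (c.decode b) ≤ c.errorProb P := by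
    refine Finset.exists_le_of_sum_le hne ?_
    rw [Finset.sum_const, nsmul_eq_mul, Scheme.errorProb, Finset.card_univ,
      mul_div_cancel₀ _ (by exact_mod_cast Fintype.card_ne_zero)]
  refine le_trans ?_ (ENNReal.ofReal_le_ofReal hb)
  -- The minimum ranges over message sets of the form `Fin m`, so messages are relabelled; this
  -- leaves the error probability unchanged.
  let e : Message X R n ≃ Fin (Nat.card (Message X R n)) := Finite.equivFin _
  have heq : SideInfo.errorProb P (fun x => e (c.encode b x))
      (fun q => c.decode b (e.symm q.1, q.2)) =
      SideInfo.errorProb P (c.encode b) (c.decode b) := by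
    simp [SideInfo.errorProb]
  rw [← heq]
  exact iInf₂_le_of_le _ hr (iInf₂_le _ _)

theorem exponentAtRate_mono (P : X × Y → ℝ) : Monotone (exponentAtRate P) := by
  intro r s hrs
  refine liminf_le_liminf (Eventually.of_forall fun n => errorExponent_anti ?_)
  exact iInf_mono fun m => iInf_mono' fun h => ⟨h.trans hrs, le_rfl⟩

end Exponent

end SideInfo

theorem mainTheorem2 {X Y : Type*} [Fintype X] [Fintype Y] (R : ℝ) (hR : 0 < R) :
    -- the reliability function exists as a limit and is bounded below
    (∀ P ∈ stdSimplex ℝ (X × Y),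
      Tendsto (fun ε : ℝ => SideInfo.exponentAtRate P (R + ε)) (𝓝[>] 0)
        (𝓝 (SideInfo.reliability R P)) ∧
      SideInfo.singleLetterExponent R P ≤ SideInfo.reliability R P) ∧
    -- for each support, schemes exist, have rate `R` asymptotically, and attain the bound for
    -- all sources with that support
    (∀ S : Set (X × Y), S.Nonempty →
      (∀ n, Nonempty (SideInfo.Scheme S R n)) ∧
      (∀ ε > 0, ∀ᶠ n : ℕ in atTop,
        1 / (n : ℝ) * Real.logb 2 (Nat.card (SideInfo.Message X R n)) ≤ R + ε) ∧
      ∀ c : (n : ℕ) → SideInfo.Scheme S R n,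
        ∀ P ∈ stdSimplex ℝ (X × Y), SideInfo.supp P = S →
          SideInfo.singleLetterExponent R P ≤
            liminf (fun n : ℕ =>
              SideInfo.errorExponent n (ENNReal.ofReal ((c n).errorProb P))) atTop) := by
  have hachieve : ∀ S : Set (X × Y), ∀ c : (n : ℕ) → SideInfo.Scheme S R n,
      ∀ P ∈ stdSimplex ℝ (X × Y), SideInfo.supp P = S →
        SideInfo.singleLetterExponent R P ≤
          liminf (fun n : ℕ =>
            SideInfo.errorExponent n (ENNReal.ofReal ((c n).errorProb P))) atTop :=
    fun S c P hP hS => SideInfo.singleLetterExponent_le_liminf hR.le c hP.1 hS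
  refine ⟨fun P hP => ?_, fun S hS => ⟨fun n => SideInfo.nonempty_scheme hS R n,
    fun ε hε => SideInfo.eventually_rate_le hR.le hε, hachieve S⟩⟩
  -- A larger rate allows more codes, so the exponent is monotone in `ε` and has a right limit at
  -- zero in the extended reals.
  have hmono : Monotone fun ε : ℝ => SideInfo.exponentAtRate P (R + ε) := fun ε ε' h =>
    SideInfo.exponentAtRate_mono P (by linarith)
  have hlim : Tendsto (fun ε : ℝ => SideInfo.exponentAtRate P (R + ε)) (𝓝[>] 0)
      (𝓝 (SideInfo.reliability R P)) :=
    tendsto_nhds_limUnder ⟨_, hmono.tendsto_nhdsGT 0⟩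
  refine ⟨hlim, ge_of_tendsto hlim ?_⟩
  filter_upwards [self_mem_nhdsWithin] with ε hε
  have hne : (SideInfo.supp P).Nonempty := by
    by_contra h
    have h0 : ∀ z, P z = 0 := fun z =>
      le_antisymm (not_lt.1 fun hz => h ⟨z, hz⟩) (hP.1 z)
    have h1 := hP.2
    simp [h0] at h1
  let c : (n : ℕ) → SideInfo.Scheme (SideInfo.supp P) R n := fun n =>
    (SideInfo.nonempty_scheme hne R n).some
  refine (hachieve _ c P hP rfl).trans (liminf_le_liminf ?_)
  filter_upwards [SideInfo.eventually_rate_le (X := X) hR.le hε] with n hn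
  exact SideInfo.errorExponent_anti (SideInfo.minErrorProb_le hR.le (c n) P hn)
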